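/- A binary tree is either a leaf $\perp$ or a node $L\wedge R$ with a left subtree $L$ and a right subtree $R$; its height is $h(\perp)=0$, $h(L\wedge R)=1+\max(h(L),h(R))$, and it is balanced if $h(R')-h(L')\in\{-1,0,1\}$ for every node, where $L'$ and $R'$ are the left and right subtrees of that node. The Tamari order $\le_{\mathrm T}$ is the reflexive and transitive closure of the right rotation, which replaces a subtree $(A\wedge B)\wedge C$ rooted at a node by $A\wedge(B\wedge C)$. For $n\ge 0$ let $b_n$ be the number of balanced binary tree intervals $[T_0,T_1]$ of trees with $n$ leaves, that is, of pairs $T_0\le_{\mathrm T}T_1$ of balanced binary trees with $n$ leaves (this number is finite). Then there is a unique formal power series $\mathcal S_{\mathrm{bi}}(x,y,z)\in\mathbb Z[[x,y,z]]$ with zero constant term such that $$\mathcal S_{\mathrm{bi}}(x,y,z)=x+\mathcal S_{\mathrm{bi}}(x^2+2xy+yz,\;x,\;x^2+xy),$$ and $$\sum_{n\ge 0} b_n x^n=\mathcal S_{\mathrm{bi}}(x,0,0).$$ -/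

import Mathlib

/-- Complete rooted planar binary trees, i.e. `BinaryTree Unit`: `BinaryTree.nil` is the leaf (the
empty tree). `wedge L R` is the tree with left subtree `L` and right subtree `R`. -/
abbrev wedge (L R : BinaryTree Unit) : BinaryTree Unit := BinaryTree.node () L R

/-- A binary tree is balanced if each of its nodes has an imbalance (height of the right subtree
minus height of the left subtree) in `{-1, 0, 1}`. -/
def IsBalanced : BinaryTree Unit → Prop
  | .nil => True
  | .node _ L R =>
      ((R.height : ℤ) - (L.height : ℤ)) ∈ ({-1, 0, 1} : Set ℤ) ∧ IsBalanced L ∧ IsBalanced R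

/-- `RightRotation T₀ T₁`: the tree `T₁` is obtained from `T₀` by replacing the subtree
`(A ∧ B) ∧ C` rooted at some node of `T₀` by `A ∧ (B ∧ C)`. -/
inductive RightRotation : BinaryTree Unit → BinaryTree Unit → Prop
  | root (A B C : BinaryTree Unit) :
      RightRotation (wedge (wedge A B) C) (wedge A (wedge B C))
  | left {L L' : BinaryTree Unit} (R : BinaryTree Unit) :
      RightRotation L L' → RightRotation (wedge L R) (wedge L' R)
  | right (L : BinaryTree Unit) {R R' : BinaryTree Unit} :
      RightRotation R R' → RightRotation (wedge L R) (wedge L R')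

/-- The Tamari order: the reflexive and transitive closure of right rotation. -/
def TamariLE : BinaryTree Unit → BinaryTree Unit → Prop :=
  Relation.ReflTransGen RightRotation

/-- The intervals `[T₀, T₁]` of the Tamari lattice whose endpoints are balanced binary trees with
`n` leaves, each given by its pair of endpoints. -/
def balancedIntervals (n : ℕ) : Set (BinaryTree Unit × BinaryTree Unit) :=
  {I | I.1.numLeaves = n ∧ I.2.numLeaves = n ∧ IsBalanced I.1 ∧ IsBalanced I.2 ∧
    TamariLE I.1 I.2}

/-- The generating series of balanced binary tree intervals by number of leaves. -/
noncomputable def balancedIntervalSeries : PowerSeries ℤ :=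
  PowerSeries.mk fun n => ((balancedIntervals n).ncard : ℤ)

/-- The substitution `(x, y, z) ↦ (x² + 2xy + yz, x, x² + xy)`,
where `x`, `y`, `z` are the variables `X 0`, `X 1`, `X 2`. -/
noncomputable def biSubst : Fin 3 → MvPowerSeries (Fin 3) ℤ :=
  ![MvPowerSeries.X 0 ^ 2 + 2 * MvPowerSeries.X 0 * MvPowerSeries.X 1
      + MvPowerSeries.X 1 * MvPowerSeries.X 2,
    MvPowerSeries.X 0,
    MvPowerSeries.X 0 ^ 2 + MvPowerSeries.X 0 * MvPowerSeries.X 1]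

/-- The substitution `(x, y, z) ↦ (x, 0, 0)`. -/
noncomputable def specSubst : Fin 3 → PowerSeries ℤ :=
  ![PowerSeries.X, 0, 0]

/-- The formal substitution `biSubst` is legitimate. -/
theorem hasSubst_biSubst : MvPowerSeries.HasSubst biSubst := by
  apply MvPowerSeries.hasSubst_of_constantCoeff_zero
  intro i
  fin_cases i <;> simp [biSubst]

/-- The formal substitution `specSubst` is legitimate. -/
theorem hasSubst_specSubst : MvPowerSeries.HasSubst specSubst := by
  apply MvPowerSeries.hasSubst_of_constantCoeff_zero
  intro i
  fin_cases i
  · exact PowerSeries.constantCoeff_X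
  · simp [specSubst]
  · simp [specSubst]

/-- `S` is a formal power series in `x`, `y`, `z` without constant term such that
`S(x, y, z) = x + S(x² + 2xy + yz, x, x² + xy)`. -/
def IsBiSeries (S : MvPowerSeries (Fin 3) ℤ) : Prop :=
  MvPowerSeries.constantCoeff S = 0 ∧
    S = MvPowerSeries.X 0 + MvPowerSeries.subst biSubst S

/-! If `T ≤ L ∧ R`, the left spine of `T` can be cut into `P ≤ L` and `Q ≤ R`
(`TamariLE.exists_spineCut`). Heights cannot drop when rotating away from a tree without left-heavy
nodes (`TamariLE.height_le`), so between balanced trees only the two topmost cuts are possible.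
Hence (`TamariLE.balanced_cases`) the endpoints of a balanced interval have equal height, and the
interval is either a componentwise pair of smaller ones or such a pair followed by one rotation at
the root.

This gives a recursion on height: the series of intervals of height `h`, of height `h - 1`, and of
those of height `h` that can be the left part of a root rotation evolve by `biSubst`, starting from
`(x, 0, 0)`. Iterating the functional equation of `S` at `(x, 0, 0)` therefore sums the series of
all heights. Existence and uniqueness of `S` hold because `biSubst` is contracting for a suitable
weighted order. -/

theorem TamariLE.refl (T : BinaryTree Unit) : TamariLE T T := Relation.ReflTransGen.refl

theorem TamariLE.trans {T₀ T₁ T₂ : BinaryTree Unit} (h : TamariLE T₀ T₁) (h' : TamariLE T₁ T₂) :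
    TamariLE T₀ T₂ := Relation.ReflTransGen.trans h h'

theorem TamariLE.wedge {L L' R R' : BinaryTree Unit} (hL : TamariLE L L') (hR : TamariLE R R') :
    TamariLE (wedge L R) (wedge L' R') :=
  TamariLE.trans
    (Relation.ReflTransGen.lift (fun T => _root_.wedge T R)
      (fun _ _ h => RightRotation.left R h) _ _ hL)
    (Relation.ReflTransGen.lift (fun T => _root_.wedge L' T)
      (fun _ _ h => RightRotation.right L' h) _ _ hR)

theorem TamariLE.rotate (A B C : BinaryTree Unit) :
    TamariLE (_root_.wedge (_root_.wedge A B) C) (_root_.wedge A (_root_.wedge B C)) :=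
  Relation.ReflTransGen.single (.root A B C)

theorem RightRotation.numLeaves_eq {T T' : BinaryTree Unit} (h : RightRotation T T') :
    T.numLeaves = T'.numLeaves := by
  induction h with
  | root A B C => simp [add_assoc]
  | left R _ ih => simp [ih]
  | right L _ ih => simp [ih]

theorem TamariLE.numLeaves_eq {T T' : BinaryTree Unit} (h : TamariLE T T') :
    T.numLeaves = T'.numLeaves := by
  induction h with
  | refl => rfl
  | tail _ h ih => exact ih.trans h.numLeaves_eq

theorem TamariLE.eq_nil {T : BinaryTree Unit} (h : TamariLE T .nil) : T = .nil := by
  have := h.numLeaves_eq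
  cases T with
  | nil => rfl
  | node u L R =>
    have := L.numLeaves_pos
    have := R.numLeaves_pos
    simp at *
    omega

/-! ### Cuts of the left spine -/

/-- `SpineCut T P Q`: the tree `P` is a proper subtree of `T` rooted at its left spine, say
`T = ((P ∧ S₁) ∧ S₂) ⋯ ∧ Sₖ`, and `Q = (S₁ ∧ S₂) ⋯ ∧ Sₖ`. -/
inductive SpineCut : BinaryTree Unit → BinaryTree Unit → BinaryTree Unit → Prop
  | root (L R : BinaryTree Unit) : SpineCut (wedge L R) L R
  | step {L P Q : BinaryTree Unit} (R : BinaryTree Unit) :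
      SpineCut L P Q → SpineCut (wedge L R) P (wedge Q R)

/-- Cuts pull back along a rotation: a cut of the rotated tree lifts to one of the original whose
pieces are equal to or below the given ones. -/
theorem RightRotation.exists_spineCut {T T' : BinaryTree Unit} (h : RightRotation T T') :
    ∀ {P' Q' : BinaryTree Unit}, SpineCut T' P' Q' →
      ∃ P Q, SpineCut T P Q ∧ TamariLE P P' ∧ TamariLE Q Q' := by
  induction h with
  | root A B C =>
    intro P' Q' h
    cases h with
    | root => exact ⟨_, _, .step C (.root A B), .refl _, .refl _⟩
    -- A cut inside `A` leaves `(Q ∧ B) ∧ C` before the rotation and `Q ∧ (B ∧ C)` after it.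
    | step _ h => exact ⟨_, _, .step C (.step B h), .refl _, .rotate _ _ _⟩
  | left R hr ih =>
    intro P' Q' h
    cases h with
    | root => exact ⟨_, _, .root _ R, .single hr, .refl _⟩
    | step _ h =>
      obtain ⟨P, Q, hc, hP, hQ⟩ := ih h
      exact ⟨_, _, .step R hc, hP, hQ.wedge (.refl R)⟩
  | right L hr ih =>
    intro P' Q' h
    cases h with
    | root => exact ⟨_, _, .root L _, .refl _, .single hr⟩
    | step _ h => exact ⟨_, _, .step _ h, .refl _, .wedge (.refl _) (.single hr)⟩

theorem TamariLE.exists_spineCut {T L R : BinaryTree Unit} (h : TamariLE T (_root_.wedge L R)) :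
    ∃ P Q, SpineCut T P Q ∧ TamariLE P L ∧ TamariLE Q R := by
  induction h using Relation.ReflTransGen.head_induction_on with
  | refl => exact ⟨_, _, .root L R, .refl _, .refl _⟩
  | head hr _ ih =>
    obtain ⟨P, Q, hc, hP, hQ⟩ := ih
    obtain ⟨P', Q', hc', hP', hQ'⟩ := hr.exists_spineCut hc
    exact ⟨_, _, hc', hP'.trans hP, hQ'.trans hQ⟩

/-! ### Heights and the structure of balanced intervals -/

/-- No node of the tree has an imbalance less than `-1`. -/
def NotLeftHeavy : BinaryTree Unit → Prop
  | .nil => True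
  | .node _ L R => L.height ≤ R.height + 1 ∧ NotLeftHeavy L ∧ NotLeftHeavy R

theorem isBalanced_wedge {L R : BinaryTree Unit} :
    IsBalanced (wedge L R) ↔ (L.height ≤ R.height + 1 ∧ R.height ≤ L.height + 1) ∧
      IsBalanced L ∧ IsBalanced R := by
  simp only [IsBalanced, Set.mem_insert_iff, Set.mem_singleton_iff]
  refine and_congr_left fun _ => ?_
  omega

theorem IsBalanced.notLeftHeavy {T : BinaryTree Unit} (h : IsBalanced T) : NotLeftHeavy T := by
  induction T with
  | nil => trivial
  | node u L R hL hR =>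
    obtain ⟨h1, h2, h3⟩ := isBalanced_wedge.1 h
    exact ⟨h1.1, hL h2, hR h3⟩

theorem SpineCut.height_lt {T P Q : BinaryTree Unit} (h : SpineCut T P Q) :
    P.height < T.height ∧ Q.height ≤ T.height := by
  induction h with
  | root L R => simp; omega
  | step R _ ih => simp; omega

/-- `Q` replaces left subtrees by ones that are no taller. This may break balance, but never creates
a left-heavy node; hence the one-sided condition. -/
theorem SpineCut.notLeftHeavy {T P Q : BinaryTree Unit} (h : SpineCut T P Q)
    (hT : NotLeftHeavy T) : NotLeftHeavy P ∧ NotLeftHeavy Q := by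
  induction h with
  | root L R => exact ⟨hT.2.1, hT.2.2⟩
  | step R hc ih =>
    obtain ⟨h1, h2, h3⟩ := hT
    have := hc.height_lt
    exact ⟨(ih h2).1, by omega, (ih h2).2, h3⟩

theorem SpineCut.isBalanced {T P Q : BinaryTree Unit} (h : SpineCut T P Q)
    (hT : IsBalanced T) : IsBalanced P := by
  induction h with
  | root L R => exact hT.2.1
  | step R _ ih => exact ih hT.2.1

theorem TamariLE.height_le {T T' : BinaryTree Unit} (h : TamariLE T T') (hT : NotLeftHeavy T) :
    T.height ≤ T'.height := by
  induction T' generalizing T with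
  | nil => simp [h.eq_nil]
  | node u L R ihL ihR =>
    obtain ⟨P, Q, hc, hP, hQ⟩ := h.exists_spineCut
    have h1 := ihL hP (hc.notLeftHeavy hT).1
    have h2 := ihR hQ (hc.notLeftHeavy hT).2
    cases hc with
    | root => simp; omega
    -- `T` has height at most `S.height + 2`, while `S` still lies at depth at least two in `Q`
    -- placed below the root.
    | step S hc =>
      have := hT.1
      have := hc.height_lt
      simp at *
      omega

/-- Balanced trees `T₀ ≤ T₁` have the same height, and either their left and right subtrees are
comparable, or `T₁` is obtained from a tree of this kind by a rotation at the root. -/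
theorem TamariLE.balanced_cases {T₀ T₁ : BinaryTree Unit} (h : TamariLE T₀ T₁)
    (h₀ : IsBalanced T₀) (h₁ : IsBalanced T₁) :
    T₀.height = T₁.height ∧
      ((T₀ = .nil ∧ T₁ = .nil) ∨
      (∃ L₀ R₀ L₁ R₁, T₀ = _root_.wedge L₀ R₀ ∧ T₁ = _root_.wedge L₁ R₁ ∧
        TamariLE L₀ L₁ ∧ TamariLE R₀ R₁) ∨
      ∃ A₀ B₀ C₀ A₁ B₁ C₁, T₀ = _root_.wedge (_root_.wedge A₀ B₀) C₀ ∧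
        T₁ = _root_.wedge A₁ (_root_.wedge B₁ C₁) ∧
        TamariLE A₀ A₁ ∧ TamariLE B₀ B₁ ∧ TamariLE C₀ C₁ ∧
        C₀.height = A₀.height ∧ B₀.height ≤ A₀.height) := by
  induction T₁ generalizing T₀ with
  | nil => simp [h.eq_nil]
  | node u L R ihL ihR =>
    obtain ⟨P, Q, hc, hP, hQ⟩ := h.exists_spineCut
    obtain ⟨⟨hh1, hh2⟩, hL, hR⟩ := isBalanced_wedge.1 h₁
    have e1 := (ihL hP (hc.isBalanced h₀) hL).1
    -- `Q` need not be balanced, so the induction hypothesis is not yet available for it.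
    have hQR := hQ.height_le (hc.notLeftHeavy h₀.notLeftHeavy).2
    cases hc with
    | root =>
      have e2 := (ihR hQ h₀.2.2 hR).1
      exact ⟨by simp [e1, e2], .inr (.inl ⟨_, _, _, _, rfl, rfl, hP, hQ⟩)⟩
    | step C₀ hc =>
      cases hc with
      | root =>
        rename_i B₀
        obtain ⟨⟨g1, g2⟩, hPB, hC⟩ := isBalanced_wedge.1 h₀
        obtain ⟨⟨g3, g4⟩, -, hB⟩ := isBalanced_wedge.1 hPB
        simp only [BinaryTree.height] at g1 g2 hQR
        -- The height bounds force `C₀` to be as tall as the cut-off `P`, and `B₀` no taller, so `Q`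
        -- is balanced after all.
        have hQb : IsBalanced (_root_.wedge B₀ C₀) := isBalanced_wedge.2 ⟨by omega, hB, hC⟩
        obtain ⟨e2, hcase⟩ := ihR hQ hQb hR
        simp only [BinaryTree.height] at e2
        refine ⟨by simp only [BinaryTree.height]; omega, .inr (.inr ?_)⟩
        rcases hcase with h | ⟨L₀, R₀, B₁, C₁, e, rfl, hB₁, hC₁⟩ | ⟨_, _, _, _, _, _, e, -, -, -, -, e', e''⟩
        · simp at h
        · obtain ⟨-, rfl, rfl⟩ := BinaryTree.node.inj e
          exact ⟨_, _, _, _, _, _, rfl, rfl, hP, hB₁, hC₁, by omega, by omega⟩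
        -- A second rotation would need `C₀` as tall as a proper subtree of `B₀`, yet `B₀` is no
        -- taller than `C₀`.
        · obtain ⟨-, rfl, rfl⟩ := BinaryTree.node.inj e
          simp only [BinaryTree.height] at *
          omega
      | step S hc =>
        -- For a deeper cut, balance at the root makes `C₀` taller than `P`; then `Q`, and so `R`,
        -- exceeds the height of `L` by at least two.
        exfalso
        have := hc.height_lt
        obtain ⟨⟨g1, g2⟩, hPB, hC⟩ := isBalanced_wedge.1 h₀
        simp only [BinaryTree.height] at *
        omega

/-- A pair `I` of balanced trees with `I.1 ≤ I.2` in the Tamari order. -/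
def IsBalancedInterval (I : BinaryTree Unit × BinaryTree Unit) : Prop :=
  IsBalanced I.1 ∧ IsBalanced I.2 ∧ TamariLE I.1 I.2

theorem IsBalancedInterval.height_eq {I : BinaryTree Unit × BinaryTree Unit}
    (h : IsBalancedInterval I) : I.1.height = I.2.height :=
  (h.2.2.balanced_cases h.1 h.2.1).1

/-- The intervals `[L₀ ∧ R₀, L₁ ∧ R₁]` for `[L₀, L₁]` in `s` and `[R₀, R₁]` in `t`. -/
def wedgePairs (s t : Finset (BinaryTree Unit × BinaryTree Unit)) :
    Finset (BinaryTree Unit × BinaryTree Unit) :=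
  (s ×ˢ t).image fun p => (wedge p.1.1 p.2.1, wedge p.1.2 p.2.2)

/-- The intervals `[L₀ ∧ C₀, A₁ ∧ (B₁ ∧ C₁)]` for `[L₀, A₁ ∧ B₁]` in `s` and `[C₀, C₁]` in `t`. -/
def rotatePairs (s t : Finset (BinaryTree Unit × BinaryTree Unit)) :
    Finset (BinaryTree Unit × BinaryTree Unit) :=
  (s ×ˢ t).image fun p => (wedge p.1.1 p.2.1, wedge p.1.2.left (wedge p.1.2.right p.2.2))

/-- The balanced intervals of height `h`, those of height `h - 1`, and those of height `h` whose
endpoints have componentwise comparable subtrees and imbalance `-1` or `0` at the root. -/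
def intervalsOfHeight : ℕ → Fin 3 → Finset (BinaryTree Unit × BinaryTree Unit)
  | 0 => ![{(.nil, .nil)}, ∅, ∅]
  | h + 1 =>
    let s := intervalsOfHeight h
    ![wedgePairs (s 0) (s 0) ∪ wedgePairs (s 0) (s 1) ∪ wedgePairs (s 1) (s 0) ∪
        rotatePairs (s 2) (s 1),
      s 0,
      wedgePairs (s 0) (s 0) ∪ wedgePairs (s 0) (s 1)]

theorem mem_wedgePairs {s t : Finset (BinaryTree Unit × BinaryTree Unit)}
    {I : BinaryTree Unit × BinaryTree Unit} : I ∈ wedgePairs s t ↔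
      ∃ L ∈ s, ∃ R ∈ t, I = (wedge L.1 R.1, wedge L.2 R.2) := by
  simp only [wedgePairs, Finset.mem_image, Finset.mem_product]
  constructor
  · rintro ⟨⟨L, R⟩, ⟨hL, hR⟩, rfl⟩
    exact ⟨L, hL, R, hR, rfl⟩
  · rintro ⟨L, hL, R, hR, rfl⟩
    exact ⟨(L, R), ⟨hL, hR⟩, rfl⟩

theorem mem_rotatePairs {s t : Finset (BinaryTree Unit × BinaryTree Unit)}
    {I : BinaryTree Unit × BinaryTree Unit} : I ∈ rotatePairs s t ↔
      ∃ L ∈ s, ∃ C ∈ t, I = (wedge L.1 C.1, wedge L.2.left (wedge L.2.right C.2)) := by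
  simp only [rotatePairs, Finset.mem_image, Finset.mem_product]
  constructor
  · rintro ⟨⟨L, R⟩, ⟨hL, hR⟩, rfl⟩
    exact ⟨L, hL, R, hR, rfl⟩
  · rintro ⟨L, hL, R, hR, rfl⟩
    exact ⟨(L, R), ⟨hL, hR⟩, rfl⟩

theorem mem_intervalsOfHeight (h : ℕ) (I : BinaryTree Unit × BinaryTree Unit) :
    (I ∈ intervalsOfHeight h 0 ↔ IsBalancedInterval I ∧ I.1.height = h) ∧
    (I ∈ intervalsOfHeight h 1 ↔ IsBalancedInterval I ∧ I.1.height + 1 = h) ∧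
    (I ∈ intervalsOfHeight h 2 ↔ ∃ A B, IsBalancedInterval A ∧ IsBalancedInterval B ∧
      A.1.height + 1 = h ∧ (B.1.height + 1 = h ∨ B.1.height + 2 = h) ∧
      I = (wedge A.1 B.1, wedge A.2 B.2)) := by
  induction h generalizing I with
  | zero =>
    refine ⟨?_, by simp [intervalsOfHeight], by simp [intervalsOfHeight]⟩
    simp only [intervalsOfHeight, Matrix.cons_val_zero, Finset.mem_singleton]
    constructor
    · rintro rfl
      exact ⟨⟨trivial, trivial, .refl _⟩, rfl⟩
    · rintro ⟨hI, h0⟩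
      have h1 := hI.height_eq
      obtain ⟨T, T'⟩ := I
      cases T <;> cases T' <;> simp_all
  | succ h ih =>
    have i0 := fun I => (ih I).1
    have i1 := fun I => (ih I).2.1
    have i2 := fun I => (ih I).2.2
    have key : ∀ {L R : BinaryTree Unit × BinaryTree Unit}, IsBalancedInterval L →
        IsBalancedInterval R → L.1.height ≤ R.1.height + 1 → R.1.height ≤ L.1.height + 1 →
        IsBalancedInterval (wedge L.1 R.1, wedge L.2 R.2) := by
      intro L R hL hR h1 h2
      have e1 := hL.height_eq
      have e2 := hR.height_eq
      exact ⟨isBalanced_wedge.2 ⟨⟨h1, h2⟩, hL.1, hR.1⟩,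
        isBalanced_wedge.2 ⟨by omega, hL.2.1, hR.2.1⟩, hL.2.2.wedge hR.2.2⟩
    refine ⟨?_, ?_, ?_⟩
    · simp only [intervalsOfHeight, Matrix.cons_val_zero, Finset.mem_union, mem_wedgePairs,
        mem_rotatePairs, i0, i1, i2]
      constructor
      · rintro (((⟨L, ⟨hL, eL⟩, R, ⟨hR, eR⟩, rfl⟩ | ⟨L, ⟨hL, eL⟩, R, ⟨hR, eR⟩, rfl⟩) |
          ⟨L, ⟨hL, eL⟩, R, ⟨hR, eR⟩, rfl⟩) |
          ⟨_, ⟨A, B, hA, hB, eA, eB, rfl⟩, C, ⟨hC, eC⟩, rfl⟩)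
        · exact ⟨key hL hR (by omega) (by omega), by simp; omega⟩
        · exact ⟨key hL hR (by omega) (by omega), by simp; omega⟩
        · exact ⟨key hL hR (by omega) (by omega), by simp; omega⟩
        · have hAB := key hA hB (by omega) (by omega)
          have hBC := key hB hC (by omega) (by omega)
          have e1 := hBC.height_eq
          have e2 := hA.height_eq
          simp only [BinaryTree.height] at e1
          refine ⟨⟨isBalanced_wedge.2 ⟨?_, hAB.1, hC.1⟩, isBalanced_wedge.2
            ⟨?_, hA.2.1, hBC.2.1⟩, (TamariLE.rotate _ _ _).trans (hA.2.2.wedge hBC.2.2)⟩, ?_⟩ <;>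
          simp only [BinaryTree.height, BinaryTree.left, BinaryTree.right] <;> omega
      · obtain ⟨T₀, T₁⟩ := I
        rintro ⟨⟨h₀, h₁, hle⟩, hh⟩
        dsimp only at h₀ h₁ hle hh
        obtain ⟨-, ⟨rfl, rfl⟩ | ⟨L₀, R₀, L₁, R₁, rfl, rfl, hL, hR⟩ |
          ⟨A₀, B₀, C₀, A₁, B₁, C₁, rfl, rfl, hA, hB, hC, e1, e2⟩⟩ := hle.balanced_cases h₀ h₁
        · simp at hh
        · have hL' : IsBalancedInterval (L₀, L₁) := ⟨h₀.2.1, h₁.2.1, hL⟩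
          have hR' : IsBalancedInterval (R₀, R₁) := ⟨h₀.2.2, h₁.2.2, hR⟩
          have := (isBalanced_wedge.1 h₀).1
          simp only [BinaryTree.height] at hh
          rcases (by omega : (L₀.height = h ∧ R₀.height = h) ∨
            (L₀.height = h ∧ R₀.height + 1 = h) ∨ (L₀.height + 1 = h ∧ R₀.height = h))
            with ⟨h1, h2⟩ | ⟨h1, h2⟩ | ⟨h1, h2⟩
          · exact .inl (.inl (.inl ⟨_, ⟨hL', h1⟩, _, ⟨hR', h2⟩, rfl⟩))
          · exact .inl (.inl (.inr ⟨_, ⟨hL', h1⟩, _, ⟨hR', h2⟩, rfl⟩))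
          · exact .inl (.inr ⟨_, ⟨hL', h1⟩, _, ⟨hR', h2⟩, rfl⟩)
        · have hA' : IsBalancedInterval (A₀, A₁) := ⟨h₀.2.1.2.1, h₁.2.1, hA⟩
          have hB' : IsBalancedInterval (B₀, B₁) := ⟨h₀.2.1.2.2, h₁.2.2.2.1, hB⟩
          have hC' : IsBalancedInterval (C₀, C₁) := ⟨h₀.2.2, h₁.2.2.2.2, hC⟩
          have := (isBalanced_wedge.1 h₀.2.1).1
          simp only [BinaryTree.height] at hh
          exact .inr ⟨_, ⟨_, _, hA', hB', by dsimp only; omega, by dsimp only; omega, rfl⟩, _,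
            ⟨hC', by dsimp only; omega⟩, rfl⟩
    · rw [add_left_inj]
      exact i0 I
    · simp only [intervalsOfHeight, Matrix.cons_val, Finset.mem_union, mem_wedgePairs, i0, i1]
      constructor
      · rintro (⟨L, ⟨hL, eL⟩, R, ⟨hR, eR⟩, rfl⟩ | ⟨L, ⟨hL, eL⟩, R, ⟨hR, eR⟩, rfl⟩)
        · exact ⟨L, R, hL, hR, by omega, by omega, rfl⟩
        · exact ⟨L, R, hL, hR, by omega, by omega, rfl⟩
      · rintro ⟨A, B, hA, hB, eA, eB | eB, rfl⟩
        · exact .inl ⟨A, ⟨hA, by omega⟩, B, ⟨hB, by omega⟩, rfl⟩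
        · exact .inr ⟨A, ⟨hA, by omega⟩, B, ⟨hB, by omega⟩, rfl⟩

/-! ### Generating series by height -/

/-- The generating series by number of leaves of a finite set of intervals. -/
noncomputable def genSeries (s : Finset (BinaryTree Unit × BinaryTree Unit)) : PowerSeries ℤ :=
  ∑ I ∈ s, PowerSeries.X ^ I.1.numLeaves

theorem coeff_genSeries (s : Finset (BinaryTree Unit × BinaryTree Unit)) (n : ℕ) :
    PowerSeries.coeff n (genSeries s) = (s.filter fun I => I.1.numLeaves = n).card := by
  rw [Finset.card_filter]
  push_cast
  simp only [genSeries, map_sum, PowerSeries.coeff_X_pow, eq_comm]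

theorem X_pow_dvd_genSeries {s : Finset (BinaryTree Unit × BinaryTree Unit)} {n : ℕ}
    (hs : ∀ I ∈ s, n ≤ I.1.height + 1) : PowerSeries.X ^ n ∣ genSeries s := by
  refine Finset.dvd_sum fun I hI => pow_dvd_pow _ ?_
  have := I.1.height_le_numNodes
  have := hs I hI
  rw [I.1.numLeaves_eq_numNodes_succ]
  omega

theorem genSeries_union {s t : Finset (BinaryTree Unit × BinaryTree Unit)} (h : Disjoint s t) :
    genSeries (s ∪ t) = genSeries s + genSeries t :=
  Finset.sum_union h

theorem genSeries_wedgePairs (s t : Finset (BinaryTree Unit × BinaryTree Unit)) :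
    genSeries (wedgePairs s t) = genSeries s * genSeries t := by
  rw [genSeries, wedgePairs, Finset.sum_image]
  · simp [genSeries, pow_add, Finset.sum_product, Finset.sum_mul_sum]
  · rintro ⟨⟨a, b⟩, c, d⟩ - ⟨⟨a', b'⟩, c', d'⟩ - h
    simp only [Prod.mk.injEq, BinaryTree.node.injEq] at h ⊢
    tauto

/-- Excluding the leaf matters for injectivity: `left` and `right` of a leaf default to leaves, so
it would collide with the tree with two leaves. -/
theorem genSeries_rotatePairs {s : Finset (BinaryTree Unit × BinaryTree Unit)}
    (t : Finset (BinaryTree Unit × BinaryTree Unit)) (hs : ∀ I ∈ s, I.2 ≠ .nil) :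
    genSeries (rotatePairs s t) = genSeries s * genSeries t := by
  rw [genSeries, rotatePairs, Finset.sum_image]
  · simp [genSeries, pow_add, Finset.sum_product, Finset.sum_mul_sum]
  · rintro ⟨⟨a, b⟩, c, d⟩ hp ⟨⟨a', b'⟩, c', d'⟩ hp' h
    simp only [Finset.coe_product, Set.mem_prod, Finset.mem_coe] at hp hp'
    have hb := BinaryTree.left_node_right_eq_self (hs _ hp.1)
    have hb' := BinaryTree.left_node_right_eq_self (hs _ hp'.1)
    simp only [Prod.mk.injEq, BinaryTree.node.injEq] at h hb hb' ⊢
    refine ⟨⟨h.1.2.1, ?_⟩, h.1.2.2, h.2.2.2.2.2⟩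
    rw [← hb, ← hb', h.2.2.1, h.2.2.2.2.1]

theorem disjoint_wedgePairs_left {s s' : Finset (BinaryTree Unit × BinaryTree Unit)}
    (t t' : Finset (BinaryTree Unit × BinaryTree Unit)) (h : Disjoint s s') :
    Disjoint (wedgePairs s t) (wedgePairs s' t') := by
  simp only [Finset.disjoint_left, mem_wedgePairs] at h ⊢
  rintro _ ⟨L, hL, R, hR, rfl⟩ ⟨L', hL', R', hR', e⟩
  simp only [Prod.mk.injEq, BinaryTree.node.injEq] at e
  exact h hL (by rwa [Prod.ext e.1.2.1 e.2.2.1])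

theorem disjoint_wedgePairs_right {t t' : Finset (BinaryTree Unit × BinaryTree Unit)}
    (s s' : Finset (BinaryTree Unit × BinaryTree Unit)) (h : Disjoint t t') :
    Disjoint (wedgePairs s t) (wedgePairs s' t') := by
  simp only [Finset.disjoint_left, mem_wedgePairs] at h ⊢
  rintro _ ⟨L, hL, R, hR, rfl⟩ ⟨L', hL', R', hR', e⟩
  simp only [Prod.mk.injEq, BinaryTree.node.injEq] at e
  exact h hR (by rwa [Prod.ext e.1.2.2 e.2.2.2])

/-- The left subtrees of the endpoints have equally many leaves in a componentwise pair, but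
strictly fewer at the upper endpoint after a root rotation. -/
theorem disjoint_wedgePairs_rotatePairs {s u : Finset (BinaryTree Unit × BinaryTree Unit)}
    (t v : Finset (BinaryTree Unit × BinaryTree Unit))
    (hs : ∀ I ∈ s, I.1.numLeaves = I.2.numLeaves)
    (hu : ∀ I ∈ u, I.1.numLeaves = I.2.numLeaves ∧ I.2 ≠ .nil) :
    Disjoint (wedgePairs s t) (rotatePairs u v) := by
  simp only [Finset.disjoint_left, mem_wedgePairs, mem_rotatePairs]
  rintro _ ⟨L, hL, R, hR, rfl⟩ ⟨L', hL', R', hR', e⟩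
  simp only [Prod.mk.injEq, BinaryTree.node.injEq] at e
  obtain ⟨h1, h2⟩ := hu _ hL'
  have h3 := hs _ hL
  rw [e.1.2.1, e.2.2.1, h1, ← BinaryTree.left_node_right_eq_self h2] at h3
  have := L'.2.right.numLeaves_pos
  simp only [BinaryTree.numLeaves, BinaryTree.left] at h3
  omega

/-- The generating series of `intervalsOfHeight h`. -/
noncomputable def heightSeries (h : ℕ) (i : Fin 3) : PowerSeries ℤ :=
  genSeries (intervalsOfHeight h i)

theorem heightSeries_zero : heightSeries 0 = specSubst := by
  funext i
  fin_cases i <;> simp [heightSeries, intervalsOfHeight, specSubst, genSeries]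

theorem X_pow_dvd_heightSeries (h : ℕ) (i : Fin 3) : PowerSeries.X ^ h ∣ heightSeries h i := by
  refine X_pow_dvd_genSeries fun I hI => ?_
  fin_cases i
  · exact ((mem_intervalsOfHeight h I).1.1 hI).2.ge.trans (Nat.le_succ _)
  · exact ((mem_intervalsOfHeight h I).2.1.1 hI).2.ge
  · obtain ⟨A, B, -, -, h1, -, rfl⟩ := (mem_intervalsOfHeight h I).2.2.1 hI
    simp
    omega

theorem heightSeries_succ (h : ℕ) :
    heightSeries (h + 1) 0 = heightSeries h 0 ^ 2 + 2 * heightSeries h 0 * heightSeries h 1 +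
      heightSeries h 1 * heightSeries h 2 ∧
    heightSeries (h + 1) 1 = heightSeries h 0 ∧
    heightSeries (h + 1) 2 = heightSeries h 0 ^ 2 + heightSeries h 0 * heightSeries h 1 := by
  have hd : Disjoint (intervalsOfHeight h 0) (intervalsOfHeight h 1) := by
    refine Finset.disjoint_left.2 fun I h0 h1 => ?_
    have := ((mem_intervalsOfHeight h I).1.1 h0).2
    have := ((mem_intervalsOfHeight h I).2.1.1 h1).2
    omega
  have hn0 : ∀ I ∈ intervalsOfHeight h 0, I.1.numLeaves = I.2.numLeaves := fun I hI =>
    ((mem_intervalsOfHeight h I).1.1 hI).1.2.2.numLeaves_eq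
  have hn1 : ∀ I ∈ intervalsOfHeight h 1, I.1.numLeaves = I.2.numLeaves := fun I hI =>
    ((mem_intervalsOfHeight h I).2.1.1 hI).1.2.2.numLeaves_eq
  have hn2 : ∀ I ∈ intervalsOfHeight h 2, I.1.numLeaves = I.2.numLeaves ∧ I.2 ≠ .nil := by
    intro I hI
    obtain ⟨A, B, hA, hB, -, -, rfl⟩ := (mem_intervalsOfHeight h I).2.2.1 hI
    simp [hA.2.2.numLeaves_eq, hB.2.2.numLeaves_eq]
  refine ⟨?_, rfl, ?_⟩
  · simp only [heightSeries, intervalsOfHeight, Matrix.cons_val_zero]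
    rw [genSeries_union, genSeries_union, genSeries_union, genSeries_rotatePairs _
      fun I hI => (hn2 I hI).2]
    · simp only [genSeries_wedgePairs]
      ring
    · exact disjoint_wedgePairs_right _ _ hd
    · exact Finset.disjoint_union_left.2
        ⟨disjoint_wedgePairs_left _ _ hd, disjoint_wedgePairs_left _ _ hd⟩
    · refine Finset.disjoint_union_left.2 ⟨Finset.disjoint_union_left.2 ⟨?_, ?_⟩, ?_⟩
      · exact disjoint_wedgePairs_rotatePairs _ _ hn0 hn2
      · exact disjoint_wedgePairs_rotatePairs _ _ hn0 hn2
      · exact disjoint_wedgePairs_rotatePairs _ _ hn1 hn2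
  · simp only [heightSeries, intervalsOfHeight, Matrix.cons_val]
    rw [genSeries_union (disjoint_wedgePairs_right _ _ hd)]
    simp only [genSeries_wedgePairs]
    ring

theorem coe_filter_biUnion_intervalsOfHeight (n : ℕ) :
    (((Finset.range (n + 1)).biUnion fun h =>
      (intervalsOfHeight h 0).filter fun I => I.1.numLeaves = n :
      Finset (BinaryTree Unit × BinaryTree Unit)) : Set (BinaryTree Unit × BinaryTree Unit)) =
      balancedIntervals n := by
  ext I
  simp only [Finset.coe_biUnion, Finset.coe_filter, Set.mem_iUnion, Set.mem_ofPred_eq,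
    balancedIntervals, Finset.coe_range, Set.mem_Iio, (mem_intervalsOfHeight _ I).1]
  constructor
  · rintro ⟨h, -, ⟨⟨h0, h1, hle⟩, -⟩, hn⟩
    exact ⟨hn, hle.numLeaves_eq ▸ hn, h0, h1, hle⟩
  · rintro ⟨hn, -, h0, h1, hle⟩
    refine ⟨I.1.height, ?_, ⟨⟨h0, h1, hle⟩, rfl⟩, hn⟩
    have := I.1.height_le_numNodes
    have := I.1.numLeaves_eq_numNodes_succ
    omega

theorem finite_balancedIntervals (n : ℕ) : (balancedIntervals n).Finite := by
  rw [← coe_filter_biUnion_intervalsOfHeight]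
  exact Finset.finite_toSet _

theorem ncard_balancedIntervals (n : ℕ) : ((balancedIntervals n).ncard : ℤ) =
    ∑ h ∈ Finset.range (n + 1), PowerSeries.coeff n (heightSeries h 0) := by
  rw [← coe_filter_biUnion_intervalsOfHeight, Set.ncard_coe_finset, Finset.card_biUnion]
  · simp [heightSeries, coeff_genSeries]
  · intro h _ h' _ hne
    refine Finset.disjoint_left.2 fun I hI hI' => hne ?_
    simp only [Finset.mem_filter, (mem_intervalsOfHeight _ I).1] at hI hI'
    rw [← hI.1.2, hI'.1.2]

/-! ### Existence and uniqueness of the solution -/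

/-- Weights of the variables for which the substitution `biSubst` raises weighted orders. -/
def biWeight : Fin 3 → ℕ := ![2, 1, 2]

/-- Ordinary degree does not suffice, since `y ↦ x` preserves it. Making `y` lighter than `x`
repairs this, and the quadratic terms then have weight at least 3. -/
theorem succ_biWeight_le_weightedOrder_biSubst (i : Fin 3) :
    ((biWeight i + 1 : ℕ) : ℕ∞) ≤ (biSubst i).weightedOrder biWeight := by
  have hX : ∀ i : Fin 3, ((biWeight i : ℕ) : ℕ∞) ≤
      (MvPowerSeries.X i : MvPowerSeries (Fin 3) ℤ).weightedOrder biWeight := fun i => by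
    rw [MvPowerSeries.X_def, MvPowerSeries.weightedOrder_monomial_of_ne_zero _ one_ne_zero]
    simp [Finsupp.weight_single]
  have hmul : ∀ {i j : Fin 3} {n : ℕ}, n ≤ biWeight i + biWeight j → (n : ℕ∞) ≤
      (MvPowerSeries.X i * MvPowerSeries.X j :
        MvPowerSeries (Fin 3) ℤ).weightedOrder biWeight := fun {i j n} h =>
    le_trans (by exact_mod_cast h)
      ((add_le_add (hX i) (hX j)).trans (MvPowerSeries.le_weightedOrder_mul _))
  have hadd : ∀ {f g : MvPowerSeries (Fin 3) ℤ} {n : ℕ∞}, n ≤ f.weightedOrder biWeight →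
      n ≤ g.weightedOrder biWeight → n ≤ (f + g).weightedOrder biWeight := fun hf hg =>
    (le_min hf hg).trans (MvPowerSeries.min_weightedOrder_le_add _)
  fin_cases i
  · simp only [biSubst, Fin.zero_eta, Matrix.cons_val_zero, sq, two_mul, add_mul]
    exact hadd (hadd (hmul (by decide)) (hadd (hmul (by decide)) (hmul (by decide))))
      (hmul (by decide))
  · exact hX 0
  · simp only [biSubst, Fin.reduceFinMk, Matrix.cons_val, sq]
    exact hadd (hmul (by decide)) (hmul (by decide))

theorem succ_le_weightedOrder_subst_biSubst {f : MvPowerSeries (Fin 3) ℤ}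
    (hf : MvPowerSeries.constantCoeff f = 0) {n : ℕ}
    (h : (n : ℕ∞) ≤ f.weightedOrder biWeight) :
    ((n + 1 : ℕ) : ℕ∞) ≤ (MvPowerSeries.subst biSubst f).weightedOrder biWeight := by
  refine le_trans ?_ (MvPowerSeries.le_weightedOrder_subst biWeight hasSubst_biSubst f)
  refine le_iInf₂ fun d hd => ?_
  have hd0 : d ≠ 0 := by
    rintro rfl
    exact hd (by simpa using hf)
  have h1 : n ≤ Finsupp.weight biWeight d := by
    exact_mod_cast h.trans (MvPowerSeries.weightedOrder_le biWeight hd)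
  -- Each variable occurring in the monomial gains at least one, and `d ≠ 0` provides at least one
  -- variable.
  have h2 : n + 1 ≤ ∑ i, d i * (biWeight i + 1) := by
    have h3 : 0 < ∑ i, d i := by
      by_contra hs
      refine hd0 (Finsupp.ext fun i => ?_)
      exact Finset.sum_eq_zero_iff.1 (Nat.eq_zero_of_not_pos hs) i (Finset.mem_univ i)
    rw [Finsupp.weight_apply, Finsupp.sum_fintype _ _ (by simp)] at h1
    simp only [smul_eq_mul] at h1
    simp only [mul_add, mul_one, Finset.sum_add_distrib]
    omega
  refine (Nat.cast_le.2 h2).trans ?_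
  rw [Finsupp.weight_apply, Finsupp.sum_fintype _ _ (by simp)]
  push_cast
  refine Finset.sum_le_sum fun i _ => ?_
  rw [nsmul_eq_mul]
  gcongr
  exact_mod_cast succ_biWeight_le_weightedOrder_biSubst i

theorem eq_zero_of_forall_le_weightedOrder {f : MvPowerSeries (Fin 3) ℤ}
    (h : ∀ n : ℕ, (n : ℕ∞) ≤ f.weightedOrder biWeight) : f = 0 := by
  rw [← MvPowerSeries.weightedOrder_eq_top_iff (w := biWeight)]
  exact ENat.eq_top_iff_forall_ge.2 h

theorem IsBiSeries.unique {S S' : MvPowerSeries (Fin 3) ℤ} (h : IsBiSeries S)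
    (h' : IsBiSeries S') : S = S' := by
  have h0 : MvPowerSeries.constantCoeff (S - S') = 0 := by simp [h.1, h'.1]
  have he : S - S' = MvPowerSeries.subst biSubst (S - S') := by
    rw [MvPowerSeries.subst_sub hasSubst_biSubst]
    nth_rw 1 [h.2, h'.2]
    ring
  refine sub_eq_zero.1 (eq_zero_of_forall_le_weightedOrder fun n => ?_)
  induction n with
  | zero => simp
  | succ n ih =>
    rw [he]
    exact succ_le_weightedOrder_subst_biSubst h0 ih

/-- Approximations of the solution of `S = X 0 + subst biSubst S`. -/
noncomputable def biApprox : ℕ → MvPowerSeries (Fin 3) ℤ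
  | 0 => 0
  | n + 1 => MvPowerSeries.X 0 + MvPowerSeries.subst biSubst (biApprox n)

theorem constantCoeff_subst_biSubst {f : MvPowerSeries (Fin 3) ℤ}
    (hf : MvPowerSeries.constantCoeff f = 0) :
    MvPowerSeries.constantCoeff (MvPowerSeries.subst biSubst f) = 0 := by
  refine MvPowerSeries.constantCoeff_subst_eq_zero hasSubst_biSubst (fun i => ?_) hf
  fin_cases i <;> simp [biSubst]

theorem constantCoeff_biApprox (n : ℕ) : MvPowerSeries.constantCoeff (biApprox n) = 0 := by
  induction n with
  | zero => simp [biApprox]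
  | succ n ih => simp [biApprox, constantCoeff_subst_biSubst ih]

theorem le_weightedOrder_biApprox_sub (n k : ℕ) :
    (n : ℕ∞) ≤ (biApprox (n + k) - biApprox n).weightedOrder biWeight := by
  induction n with
  | zero => simp
  | succ n ih =>
    have he : biApprox (n + 1 + k) - biApprox (n + 1) =
        MvPowerSeries.subst biSubst (biApprox (n + k) - biApprox n) := by
      rw [Nat.add_right_comm, biApprox, biApprox, MvPowerSeries.subst_sub hasSubst_biSubst]
      ring
    rw [he]
    exact succ_le_weightedOrder_subst_biSubst (by simp [constantCoeff_biApprox]) ih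

theorem exists_isBiSeries : ∃ S, IsBiSeries S := by
  -- The coefficient at `d` is stable from index `weight d + 1` on, since later approximations
  -- differ only in larger weights.
  let S : MvPowerSeries (Fin 3) ℤ := fun d =>
    MvPowerSeries.coeff d (biApprox (Finsupp.weight biWeight d + 1))
  have hS : ∀ d, MvPowerSeries.coeff d S =
    MvPowerSeries.coeff d (biApprox (Finsupp.weight biWeight d + 1)) := fun _ => rfl
  have h0 : MvPowerSeries.constantCoeff S = 0 := by
    rw [← MvPowerSeries.coeff_zero_eq_constantCoeff_apply, hS,
      MvPowerSeries.coeff_zero_eq_constantCoeff_apply, constantCoeff_biApprox]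
  have ho : ∀ n : ℕ, (n : ℕ∞) ≤ (S - biApprox n).weightedOrder biWeight := by
    refine fun n => MvPowerSeries.nat_le_weightedOrder biWeight fun d hd => ?_
    obtain ⟨k, rfl⟩ := Nat.exists_eq_add_of_lt hd
    have := MvPowerSeries.coeff_eq_zero_of_lt_weightedOrder biWeight
      (lt_of_lt_of_le (by exact_mod_cast Nat.lt_succ_self _)
        (le_weightedOrder_biApprox_sub (Finsupp.weight biWeight d + 1) k))
    rw [map_sub, sub_eq_zero] at this
    rw [map_sub, hS, Nat.add_right_comm, this, sub_self]
  refine ⟨S, h0, sub_eq_zero.1 (eq_zero_of_forall_le_weightedOrder fun n => ?_)⟩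
  have he : S - (MvPowerSeries.X 0 + MvPowerSeries.subst biSubst S) =
      (S - biApprox (n + 1)) + -MvPowerSeries.subst biSubst (S - biApprox n) := by
    rw [MvPowerSeries.subst_sub hasSubst_biSubst, biApprox]
    ring
  rw [he]
  refine le_trans (le_min ?_ ?_) (MvPowerSeries.min_weightedOrder_le_add biWeight)
  · exact le_trans (by exact_mod_cast n.le_succ) (ho (n + 1))
  · rw [MvPowerSeries.weightedOrder_neg]
    exact le_trans (by exact_mod_cast n.le_succ) (succ_le_weightedOrder_subst_biSubst
      (by simp [h0, constantCoeff_biApprox]) (ho n))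

/-! ### Iterating the functional equation -/

theorem constantCoeff_heightSeries (h : ℕ) (i : Fin 3) :
    PowerSeries.constantCoeff (heightSeries h i) = 0 := by
  simp [heightSeries, genSeries, fun T : BinaryTree Unit => T.numLeaves_pos.ne']

theorem hasSubst_heightSeries (h : ℕ) : MvPowerSeries.HasSubst (heightSeries h) :=
  MvPowerSeries.hasSubst_of_constantCoeff_zero (constantCoeff_heightSeries h)

theorem subst_heightSeries_biSubst (h : ℕ) (i : Fin 3) :
    (MvPowerSeries.subst (heightSeries h) (biSubst i) : PowerSeries ℤ) =
      heightSeries (h + 1) i := by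
  obtain ⟨h0, h1, h2⟩ := heightSeries_succ h
  have hs := hasSubst_heightSeries h
  rw [← MvPowerSeries.coe_substAlgHom hs]
  fin_cases i
  · simp only [biSubst, Fin.zero_eta, Matrix.cons_val_zero, map_add, map_mul, map_pow, map_ofNat,
      MvPowerSeries.substAlgHom_X hs]
    exact h0.symm
  · simp only [biSubst, Fin.mk_one, Matrix.cons_val_one, Matrix.cons_val_zero,
      MvPowerSeries.substAlgHom_X hs]
    exact h1.symm
  · simp only [biSubst, Fin.reduceFinMk, Matrix.cons_val, map_add, map_mul, map_pow,
      MvPowerSeries.substAlgHom_X hs]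
    exact h2.symm

theorem IsBiSeries.subst_heightSeries {S : MvPowerSeries (Fin 3) ℤ} (hS : IsBiSeries S) (h : ℕ) :
    (MvPowerSeries.subst (heightSeries h) S : PowerSeries ℤ) =
      heightSeries h 0 + MvPowerSeries.subst (heightSeries (h + 1)) S := by
  have hs := hasSubst_heightSeries h
  nth_rw 1 [hS.2]
  rw [MvPowerSeries.subst_add hs, MvPowerSeries.subst_X hs,
    MvPowerSeries.subst_comp_subst_apply hasSubst_biSubst hs]
  simp only [subst_heightSeries_biSubst]

theorem IsBiSeries.subst_specSubst {S : MvPowerSeries (Fin 3) ℤ} (hS : IsBiSeries S) (n : ℕ) :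
    (MvPowerSeries.subst specSubst S : PowerSeries ℤ) =
      ∑ h ∈ Finset.range n, heightSeries h 0 + MvPowerSeries.subst (heightSeries n) S := by
  induction n with
  | zero => simp [heightSeries_zero]
  | succ n ih => rw [ih, hS.subst_heightSeries, Finset.sum_range_succ, add_assoc]

/-- The remainder of the iteration vanishes in the limit: a tree of height `h - 1` already has at
least `h` leaves, so every nonconstant monomial becomes divisible by `X ^ h`. -/
theorem coeff_subst_heightSeries {f : MvPowerSeries (Fin 3) ℤ}
    (hf : MvPowerSeries.constantCoeff f = 0) {n h : ℕ} (hn : n < h) :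
    PowerSeries.coeff n (MvPowerSeries.subst (heightSeries h) f : PowerSeries ℤ) = 0 := by
  rw [PowerSeries.coeff, MvPowerSeries.coeff_subst (hasSubst_heightSeries h)]
  refine finsum_eq_zero_of_forall_eq_zero fun d => ?_
  by_cases hd : d = 0
  · subst hd
    rw [MvPowerSeries.coeff_zero_eq_constantCoeff_apply, hf, zero_smul]
  obtain ⟨i, hi⟩ := Finsupp.ne_iff.1 hd
  have hdvd : PowerSeries.X ^ h ∣ d.prod fun s e => heightSeries h s ^ e :=
    ((X_pow_dvd_heightSeries h i).trans (dvd_pow_self _ hi)).trans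
      (Finset.dvd_prod_of_mem (fun s => heightSeries h s ^ d s) (Finsupp.mem_support_iff.2 hi))
  exact smul_eq_zero_of_right _ (PowerSeries.X_pow_dvd_iff.1 hdvd n hn)

theorem mainTheorem5 :
    (∀ n : ℕ, (balancedIntervals n).Finite) ∧
    (∃! S : MvPowerSeries (Fin 3) ℤ, IsBiSeries S) ∧
    ∀ S : MvPowerSeries (Fin 3) ℤ, IsBiSeries S →
      (MvPowerSeries.subst specSubst S : PowerSeries ℤ) = balancedIntervalSeries := by
  refine ⟨finite_balancedIntervals, ?_, fun S hS => ?_⟩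
  · obtain ⟨S, hS⟩ := exists_isBiSeries
    exact ⟨S, hS, fun S' hS' => hS'.unique hS⟩
  · ext n
    rw [hS.subst_specSubst (n + 1), map_add, coeff_subst_heightSeries hS.1 n.lt_succ_self,
      add_zero, map_sum, balancedIntervalSeries, PowerSeries.coeff_mk, ncard_balancedIntervals]
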